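/- A \emph{negotiation diagram} $\mathcal N$ consists of a finite set $\mathit{Proc}$ of processes, a finite set $N$ of nodes, a non-empty domain $\mathit{dom}(m)\subseteq \mathit{Proc}$ and a set $\mathit{out}(m)$ of outcomes for every node $m$, initial and final nodes $n_{init},n_{fin}$ with $\mathit{dom}(n_{init})=\mathit{dom}(n_{fin})=\mathit{Proc}$, and sets $\delta(m,b,p)\subseteq N$ for $m\in N$, $b\in \mathit{out}(m)$, $p\in \mathit{dom}(m)$, such that $p\in \mathit{dom}(m')$ for all $m'\in\delta(m,b,p)$; every node other than $n_{fin}$ has at least one outcome. It is \emph{deterministic} if every $\delta(m,b,p)$ has at most one element. A \emph{location} is a pair $(m,b)$ with $b\in\mathit{out}(m)$; its domain is $\mathit{dom}(m)$. A \emph{configuration} is a map $C:\mathit{Proc}\to\mathcal P(N)$; it \emph{enables} $m$ if $m\in C(p)$ for all $p\in \mathit{dom}(m)$. Then a location $(m,b)$ can be executed in $C$ and gives $C'$ with $C'(p)=\delta(m,b,p)$ for $p\in \mathit{dom}(m)$ and $C'(p)=C(p)$ otherwise. A \emph{run} is a sequence of successive executions; the initial and final configurations are constantly $\{n_{init}\}$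 and $\{n_{fin}\}$. A configuration is \emph{reachable} if a finite run leads to it from the initial configuration, and a node is reachable if some reachable configuration enables it. $\mathcal N$ is \emph{sound} if every finite run from the initial configuration can be extended to a finite run that ends in the final configuration. A sequence of locations is a \emph{strict $n$-sequence} if all their domains are included in $\mathit{dom}(n)$, and strictly so except possibly that of the first location. Let $\mathcal N$ be a sound deterministic negotiation diagram, $n$ a reachable node and $\ell=(n,a)$ a location. Then there is a unique reachable configuration $I(n)$ that enables $n$ and no other node, and there is a unique configuration $F(\ell)$ that is reached from $I(n)$ by a strict $n$-sequence starting with $\ell$ and enables no node $m$ with $\mathit{dom}(m)\subsetneq \mathit{dom}(n)$. Let $\mathcal N|_\ell$ have the set of processes $\mathit{dom}(n)$, initial node $n$, and, as nodes and locations, those that appear in the strict $n$-sequences from $I(n)$ to $F(\ell)$ that start with $\ell$ (with their domains in $\mathcal N$; so $n$ has the single outcome $a$), together with a new final node $n|^{fin}_\ell$ with domain $\mathit{dom}(n)$ and without outcomes. For its locations $(m,b)$ and $p\in\mathit{dom}(m)$ let $\delta|_\ell(m,b,p)=\delta(m,b,p)$ if $\delta(m,b,p)\neq F(\ell)(p)$,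 and $\delta|_\ell(m,b,p)=\{n|^{fin}_\ell\}$ otherwise. Then $\mathcal N|_\ell$ is again a negotiation diagram, and it is deterministic and sound. -/

import Mathlib

/-- The data of a negotiation diagram with set of processes `P`: a set of nodes (in an ambient
type `ν`), the domain of each node, its set of outcomes (in `R`), the transition function, and the
initial and final nodes. The transition function is partial: the value `δ n a p` is meaningful only
if `n` is a node, `a` is an outcome of `n` and `p` is in the domain of `n`; other values of `dom`,
`out` and `δ` are never used. -/
structure NegDiagram (P ν R : Type*) where
  nodes : Set ν
  dom : ν → Set P
  out : ν → Set R
  δ : ν → R → P → Set ν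
  init : ν
  fin : ν

namespace NegDiagram

/-- The requirements that make the data a negotiation diagram. -/
structure IsNegotiation {P ν R : Type*} (N : NegDiagram P ν R) : Prop where
  finite_procs : Finite P
  finite_nodes : N.nodes.Finite
  init_mem : N.init ∈ N.nodes
  fin_mem : N.fin ∈ N.nodes
  dom_nonempty : ∀ n ∈ N.nodes, (N.dom n).Nonempty
  dom_init : N.dom N.init = Set.univ
  dom_fin : N.dom N.fin = Set.univ
  out_nonempty : ∀ n ∈ N.nodes, n ≠ N.fin → (N.out n).Nonempty
  δ_mem : ∀ n ∈ N.nodes, ∀ a ∈ N.out n, ∀ p ∈ N.dom n, ∀ m ∈ N.δ n a p,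
    m ∈ N.nodes ∧ p ∈ N.dom m

/-- A configuration maps each process to the set of nodes in which it is ready to engage. -/
abbrev Config (P ν : Type*) := P → Set ν

variable {P ν R : Type*} (N : NegDiagram P ν R)

/-- Every process has at most one successor node after every location. -/
def Deterministic : Prop :=
  ∀ n ∈ N.nodes, ∀ a ∈ N.out n, ∀ p ∈ N.dom n, (N.δ n a p).Subsingleton

def Enabled (C : Config P ν) (n : ν) : Prop :=
  n ∈ N.nodes ∧ ∀ p ∈ N.dom n, n ∈ C p

/-- `N.Step C l C'`: executing the location `l` in `C` produces `C'`. -/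
def Step (C : Config P ν) (l : ν × R) (C' : Config P ν) : Prop :=
  N.Enabled C l.1 ∧ l.2 ∈ N.out l.1 ∧
    (∀ p ∈ N.dom l.1, C' p = N.δ l.1 l.2 p) ∧ (∀ p ∉ N.dom l.1, C' p = C p)

/-- `N.Run C w C'`: the finite sequence of locations `w` is a run from `C` to `C'`. -/
def Run : Config P ν → List (ν × R) → Config P ν → Prop
  | C, [], C' => C = C'
  | C, l :: w, C' => ∃ D, N.Step C l D ∧ Run D w C'

def initConfig : Config P ν := fun _ => {N.init}

def finConfig : Config P ν := fun _ => {N.fin}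

/-- Reachability from the initial configuration. -/
def Reachable (C : Config P ν) : Prop := ∃ w, N.Run N.initConfig w C

/-- Every finite run from the initial configuration can be completed to a successful run. -/
def Sound : Prop :=
  ∀ w C, N.Run N.initConfig w C → ∃ w', N.Run C w' N.finConfig

/-- A node is reachable if some reachable configuration enables it. -/
def ReachableNode (n : ν) : Prop := ∃ C, N.Reachable C ∧ N.Enabled C n

/-- All domains are included in `X`, and strictly so except possibly that of the first location. -/
def IsStrictSeq (X : Set P) (w : List (ν × R)) : Prop :=
  (∀ l ∈ w, N.dom l.1 ⊆ X) ∧ ∀ l ∈ w.tail, N.dom l.1 ⊂ X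

/-- `I` is a reachable configuration that enables `n` and no other node. -/
def IsFirst (n : ν) (I : Config P ν) : Prop :=
  N.Reachable I ∧ N.Enabled I n ∧ ∀ m, N.Enabled I m → m = n

/-- The configuration `I(n)`: the unique one satisfying `IsFirst`. -/
noncomputable def first (n : ν) : Config P ν := Classical.epsilon (N.IsFirst n)

/-- `F` is reachable from `I(n)` by a strict `n`-sequence that starts with `(n, a)`, and it enables
no node whose domain is strictly included in that of `n`. -/
def IsLast (n : ν) (a : R) (F : Config P ν) : Prop :=
  (∃ u, N.IsStrictSeq (N.dom n) ((n, a) :: u) ∧ N.Run (N.first n) ((n, a) :: u) F) ∧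
    ∀ m, N.Enabled F m → ¬ N.dom m ⊂ N.dom n

/-- The configuration `F(n, a)`: the unique one satisfying `IsLast`. -/
noncomputable def last (n : ν) (a : R) : Config P ν := Classical.epsilon (N.IsLast n a)

/-- The location `l` appears in some strict `n`-sequence from `I(n)` to `F(n, a)` that starts
with `(n, a)`. -/
def Appears (n : ν) (a : R) (l : ν × R) : Prop :=
  ∃ u, N.IsStrictSeq (N.dom n) ((n, a) :: u) ∧
    N.Run (N.first n) ((n, a) :: u) (N.last n a) ∧ l ∈ (n, a) :: u

open Classical in
/-- The subnegotiation induced by the location `(n, a)`. Its processes are those of `dom n`; its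
nodes are the old nodes `some m` that appear, and the new final node `none`. -/
noncomputable def subLoc (n : ν) (a : R) : NegDiagram (N.dom n) (Option ν) R where
  nodes := {x | x = none ∨ ∃ m b, x = some m ∧ N.Appears n a (m, b)}
  dom
    | none => Set.univ
    | some m => {p | (p : P) ∈ N.dom m}
  out
    | none => ∅
    | some m => {b | N.Appears n a (m, b)}
  δ
    | none, _, _ => ∅
    | some m, b, p => if N.δ m b p = N.last n a p then {none} else some '' N.δ m b p
  init := some n
  fin := none

end NegDiagram

/-! Soundness yields a terminating strategy. Reading successful runs backwards shows that every node
occurring in a reachable configuration, other than the final one, has an outcome sending all its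
processes to nodes of smaller rank (`IsSoundDet.exists_isStrategy`). With these outcomes fixed, each
process has a forced path. The crux is that the processes of a node share their fate: from a
reachable configuration, either all of them are bound to visit it or none is
(`IsStrategy.passes_of_passes`). Comparing two distinct reachable configurations at a difference of
maximal rank then shows that one of them enables a node which its processes will not visit from the
other (`IsStrategy.exists_separates`).

I(n) and F(n, a) exist because the strategy, restricted to suitable nodes, gets exhausted. They are
unique by separation. For I(n) the separating node would be n, where both candidates agree. For F(n,
a) its domain would be exactly that of n; strict steps always leave some process of it unmoved, so
they cannot change its fate (`IsStrategy.passes_iff_of_run`).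

By uniqueness, every strict sequence that starts with (n, a) extends to one ending in F(n, a).
Soundness of the subnegotiation follows by translating runs along `subConfig`; this is faithful
because no process waits in F(n, a) for a node of smaller domain enabled on the way
(`IsSoundDet.notMem_last`). -/

namespace NegDiagram

variable {P ν R : Type*} {N : NegDiagram P ν R}

/-- A sound deterministic negotiation diagram. -/
structure IsSoundDet (N : NegDiagram P ν R) : Prop where
  isNegotiation : N.IsNegotiation
  deterministic : N.Deterministic
  sound : N.Sound

/-! ### Runs -/

lemma Step.unique {C D E : Config P ν} {l : ν × R} (h₁ : N.Step C l D) (h₂ : N.Step C l E) :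
    D = E := by
  funext p
  by_cases hp : p ∈ N.dom l.1
  · rw [h₁.2.2.1 p hp, h₂.2.2.1 p hp]
  · rw [h₁.2.2.2 p hp, h₂.2.2.2 p hp]

lemma Enabled.exists_step {C : Config P ν} {m : ν} (h : N.Enabled C m) {b : R}
    (hb : b ∈ N.out m) : ∃ D, N.Step C (m, b) D := by
  classical
  refine ⟨fun p => if p ∈ N.dom m then N.δ m b p else C p, h, hb, ?_, ?_⟩
  · intro p hp
    exact if_pos hp
  · intro p hp
    exact if_neg hp

lemma run_append {u v : List (ν × R)} {C D : Config P ν} :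
    N.Run C (u ++ v) D ↔ ∃ E, N.Run C u E ∧ N.Run E v D := by
  induction u generalizing C with
  | nil => simp [Run]
  | cons l u ih =>
    simp only [List.cons_append, Run, ih]
    constructor
    · rintro ⟨E, h, F, h₁, h₂⟩
      exact ⟨F, ⟨E, h, h₁⟩, h₂⟩
    · rintro ⟨F, ⟨E, h, h₁⟩, h₂⟩
      exact ⟨E, h, F, h₁, h₂⟩

lemma Run.trans {u v : List (ν × R)} {C D E : Config P ν} (h₁ : N.Run C u D)
    (h₂ : N.Run D v E) : N.Run C (u ++ v) E :=
  run_append.2 ⟨D, h₁, h₂⟩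

lemma Step.run {l : ν × R} {C D : Config P ν} (h : N.Step C l D) : N.Run C [l] D :=
  ⟨D, h, rfl⟩

lemma Run.eq_of_disjoint {w : List (ν × R)} {C D : Config P ν} (h : N.Run C w D) {p : P}
    (hp : ∀ l ∈ w, p ∉ N.dom l.1) : D p = C p := by
  induction w generalizing C with
  | nil =>
    cases h
    rfl
  | cons l w ih =>
    obtain ⟨E, hE, h⟩ := h
    rw [ih h fun l' hl' => hp l' (List.mem_cons_of_mem _ hl'), hE.2.2.2 p (hp l List.mem_cons_self)]

lemma Reachable.run {C D : Config P ν} {w : List (ν × R)} (hC : N.Reachable C)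
    (h : N.Run C w D) : N.Reachable D :=
  let ⟨u, hu⟩ := hC
  ⟨u ++ w, hu.trans h⟩

lemma Reachable.step {C D : Config P ν} {l : ν × R} (hC : N.Reachable C)
    (h : N.Step C l D) : N.Reachable D :=
  hC.run h.run

lemma Reachable.induction {motive : Config P ν → Prop} (init : motive N.initConfig)
    (step : ∀ C l D, motive C → N.Step C l D → motive D) {C : Config P ν}
    (hC : N.Reachable C) : motive C := by
  obtain ⟨w, hw⟩ := hC
  have key : ∀ (w : List (ν × R)) (D : Config P ν), motive D → N.Run D w C → motive C := by
    intro w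
    induction w with
    | nil =>
      intro D hD h
      cases h
      exact hD
    | cons l w ih =>
      rintro D hD ⟨E, hE, h⟩
      exact ih E (step D l E hD hE) h
  exact key w _ init hw

/-! ### Reachable configurations are functions from processes to nodes -/

/-- An empty value can never be refilled: a step that moves `p` requires `p` to be ready for its
node. -/
lemma Run.nonempty {w : List (ν × R)} {C D : Config P ν} (h : N.Run C w D) {p : P}
    (hp : (D p).Nonempty) : (C p).Nonempty := by
  induction w generalizing C with
  | nil =>
    cases h
    exact hp
  | cons l w ih =>
    obtain ⟨E, hE, h⟩ := h
    by_cases hl : p ∈ N.dom l.1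
    · exact ⟨_, hE.1.2 p hl⟩
    · rw [← hE.2.2.2 p hl]
      exact ih h

namespace IsSoundDet

lemma exists_run_fin (h : N.IsSoundDet) {C : Config P ν} (hC : N.Reachable C) :
    ∃ w, N.Run C w N.finConfig :=
  let ⟨u, hu⟩ := hC
  h.sound u C hu

/-- Determinism gives at most one node; soundness gives at least one, since a process with none
could not reach `N.fin`. -/
lemma eq_singleton (h : N.IsSoundDet) {C : Config P ν} (hC : N.Reachable C) (p : P) :
    ∃ x, C p = {x} ∧ x ∈ N.nodes ∧ p ∈ N.dom x := by
  have hsub : ∀ p, (C p).Subsingleton ∧ ∀ x ∈ C p, x ∈ N.nodes ∧ p ∈ N.dom x := by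
    refine Reachable.induction
      (motive := fun C => ∀ p, (C p).Subsingleton ∧ ∀ x ∈ C p, x ∈ N.nodes ∧ p ∈ N.dom x)
      ?_ ?_ hC
    · intro p
      refine ⟨Set.subsingleton_singleton, ?_⟩
      rintro x rfl
      exact ⟨h.isNegotiation.init_mem, by rw [h.isNegotiation.dom_init]; trivial⟩
    · intro C l D ih hs p
      by_cases hp : p ∈ N.dom l.1
      · rw [hs.2.2.1 p hp]
        exact ⟨h.deterministic _ hs.1.1 _ hs.2.1 p hp,
          fun x hx => h.isNegotiation.δ_mem _ hs.1.1 _ hs.2.1 p hp x hx⟩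
      · rw [hs.2.2.2 p hp]
        exact ih p
  obtain ⟨w, hw⟩ := h.exists_run_fin hC
  obtain ⟨x, hx⟩ := hw.nonempty (p := p) ⟨N.fin, rfl⟩
  exact ⟨x, (hsub p).1.eq_singleton_of_mem hx, (hsub p).2 x hx⟩

lemma eq_of_mem (h : N.IsSoundDet) {C : Config P ν} (hC : N.Reachable C) {p : P} {x y : ν}
    (hx : x ∈ C p) (hy : y ∈ C p) : x = y := by
  obtain ⟨z, hz, -⟩ := h.eq_singleton hC p
  rw [hz] at hx hy
  exact hx.trans hy.symm

lemma eq_fin_of_enabled (h : N.IsSoundDet) {C : Config P ν} (hC : N.Reachable C)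
    (hf : N.Enabled C N.fin) : C = N.finConfig := by
  funext p
  obtain ⟨x, hx, -⟩ := h.eq_singleton hC p
  have := hf.2 p (by rw [h.isNegotiation.dom_fin]; trivial)
  rw [hx] at this ⊢
  rw [← Set.mem_singleton_iff.1 this, finConfig]

lemma eq_of_enabled (h : N.IsSoundDet) {C : Config P ν} (hC : N.Reachable C) {k m : ν}
    (hk : N.Enabled C k) (hm : N.Enabled C m) {p : P} (hpk : p ∈ N.dom k) (hpm : p ∈ N.dom m) :
    k = m :=
  h.eq_of_mem hC (hk.2 p hpk) (hm.2 p hpm)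

/-- A process of `m` is ready for `m` alone, so only a location of `m` can move it. -/
lemma enabled_of_run (h : N.IsSoundDet) {C D : Config P ν} (hC : N.Reachable C)
    {w : List (ν × R)} {m : ν} (hw : N.Run C w D) (hm : N.Enabled C m)
    (hne : ∀ l ∈ w, l.1 ≠ m) : N.Enabled D m := by
  induction w generalizing C with
  | nil =>
    cases hw
    exact hm
  | cons l w ih =>
    obtain ⟨E, hE, hw⟩ := hw
    refine ih (hC.step hE) hw ⟨hm.1, fun p hp => ?_⟩ fun l' hl' => hne l' (List.mem_cons_of_mem _ hl')
    rw [hE.2.2.2 p fun hp' =>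
      hne l List.mem_cons_self (h.eq_of_enabled hC hE.1 hm hp' hp)]
    exact hm.2 p hp

end IsSoundDet

/-! ### Strategies that terminate -/

/-- The final node is attracted, and so is every node that has an outcome all of whose successors
are attracted; the number bounds the length of the paths to the final node. -/
inductive Attracted (N : NegDiagram P ν R) : ℕ → ν → Prop
  | fin (k : ℕ) : Attracted N k N.fin
  | step (k : ℕ) (m : ν) (b : R) (hb : b ∈ N.out m)
      (h : ∀ p ∈ N.dom m, ∀ x ∈ N.δ m b p, Attracted N k x) : Attracted N (k + 1) m

lemma Attracted.mono {j k : ℕ} {m : ν} (h : N.Attracted j m) (hjk : j ≤ k) :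
    N.Attracted k m := by
  induction h generalizing k with
  | fin => exact .fin k
  | step j m b hb _ ih =>
    obtain ⟨k, rfl⟩ : ∃ i, k = i + 1 := ⟨k - 1, by omega⟩
    exact .step k m b hb fun p hp x hx => ih p hp x hx (by omega)

/-- The choice `σ` of an outcome for every node of `S` moves all processes to nodes of `S` of
smaller rank, and `S` contains all nodes that occur in reachable configurations. -/
structure IsStrategy (N : NegDiagram P ν R) (S : Set ν) (σ : ν → R) (r : ν → ℕ) : Prop where
  mem : ∀ C, N.Reachable C → ∀ p, ∀ x ∈ C p, x ∈ S
  out : ∀ x ∈ S, x ≠ N.fin → σ x ∈ N.out x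
  next : ∀ x ∈ S, x ≠ N.fin → ∀ p ∈ N.dom x, ∀ y ∈ N.δ x (σ x) p, y ∈ S ∧ r y < r x

/-- Backward induction along a successful run: the outcome executed there witnesses the attraction
of its node. -/
lemma IsSoundDet.attracted (h : N.IsSoundDet) {C : Config P ν} (hC : N.Reachable C) :
    ∃ k, ∀ p, ∀ x ∈ C p, N.Attracted k x := by
  obtain ⟨w, hw⟩ := h.exists_run_fin hC
  induction w generalizing C with
  | nil =>
    cases hw
    refine ⟨0, ?_⟩
    rintro p x rfl
    exact .fin 0
  | cons l w ih =>
    obtain ⟨D, hD, hw⟩ := hw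
    obtain ⟨k, hk⟩ := ih (hC.step hD) hw
    refine ⟨k + 1, fun p x hx => ?_⟩
    by_cases hp : p ∈ N.dom l.1
    · rw [h.eq_of_mem hC hx (hD.1.2 p hp)]
      exact .step k _ l.2 hD.2.1 fun q hq y hy => hk q y (by rwa [hD.2.2.1 q hq])
    · exact (hk p x (by rwa [hD.2.2.2 p hp])).mono k.le_succ

lemma IsSoundDet.exists_isStrategy [Nonempty R] (h : N.IsSoundDet) :
    ∃ S σ r, N.IsStrategy S σ r := by
  classical
  -- The hypothesis sits inside the existential so that `choose` gives total functions, with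
  -- arbitrary values off the attracted set. The rank is the least bound, hence drops under the
  -- chosen outcome.
  have hex : ∀ x, ∃ (b : R) (k : ℕ), (∃ j, N.Attracted j x) →
      N.Attracted k x ∧ (∀ j, N.Attracted j x → k ≤ j) ∧ (x ≠ N.fin → b ∈ N.out x ∧
        ∀ p ∈ N.dom x, ∀ y ∈ N.δ x b p, ∃ j < k, N.Attracted j y) := by
    intro x
    by_cases hx : ∃ j, N.Attracted j x
    · have hs := Nat.find_spec hx
      have hmin := fun j (hj : N.Attracted j x) => Nat.find_min' hx hj
      generalize Nat.find hx = k at hs hmin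
      cases hs with
      | fin k =>
        exact ⟨Classical.arbitrary R, k, fun _ => ⟨.fin k, hmin, fun hne => absurd rfl hne⟩⟩
      | step k m b hb hs =>
        exact ⟨b, k + 1, fun _ => ⟨.step k x b hb hs, hmin, fun _ => ⟨hb, fun p hp y hy =>
          ⟨k, k.lt_succ_self, hs p hp y hy⟩⟩⟩⟩
    · exact ⟨Classical.arbitrary R, 0, fun h => absurd h hx⟩
  choose σ r hσ using hex
  refine ⟨{x | ∃ j, N.Attracted j x}, σ, r, fun C hC p x hx => ?_, fun x hx hne => ?_,
    fun x hx hne p hp y hy => ?_⟩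
  · obtain ⟨k, hk⟩ := h.attracted hC
    exact ⟨k, hk p x hx⟩
  · exact ((hσ x hx).2.2 hne).1
  · obtain ⟨j, hj, hy⟩ := ((hσ x hx).2.2 hne).2 p hp y hy
    exact ⟨⟨j, hy⟩, ((hσ y ⟨j, hy⟩).2.1 j hy).trans_lt hj⟩

/-- One step of the strategy `σ` from a reachable configuration. -/
def StrategyStep (N : NegDiagram P ν R) (σ : ν → R) (D C : Config P ν) : Prop :=
  N.Reachable C ∧ ∃ m, m ≠ N.fin ∧ N.Step C (m, σ m) D

namespace IsStrategy

variable {S : Set ν} {σ : ν → R} {r : ν → ℕ}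

lemma exists_step (hσ : N.IsStrategy S σ r) (h : N.IsSoundDet) {C : Config P ν}
    (hC : N.Reachable C) {m : ν} (hm : N.Enabled C m) (hne : m ≠ N.fin) :
    ∃ D, N.Step C (m, σ m) D := by
  obtain ⟨p, hp⟩ := h.isNegotiation.dom_nonempty m hm.1
  exact hm.exists_step (hσ.out m (hσ.mem C hC p m (hm.2 p hp)) hne)

lemma rank_lt (hσ : N.IsStrategy S σ r) (h : N.IsSoundDet) {C D : Config P ν}
    (hC : N.Reachable C) {m : ν} (hne : m ≠ N.fin) (hs : N.Step C (m, σ m) D) {p : P}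
    (hp : p ∈ N.dom m) {x y : ν} (hx : x ∈ C p) (hy : y ∈ D p) : r y < r x := by
  have hm := hs.1.2 p hp
  rw [hs.2.2.1 p hp] at hy
  rw [h.eq_of_mem hC hx hm]
  exact (hσ.next m (hσ.mem C hC p m hm) hne p hp y hy).2

lemma wellFounded (hσ : N.IsStrategy S σ r) (h : N.IsSoundDet) :
    WellFounded (N.StrategyStep σ) := by
  have := h.isNegotiation.finite_procs
  have := Fintype.ofFinite P
  -- Values of reachable configurations are singletons, so `sSup` only reads off the rank of the
  -- element.
  let μ : Config P ν → ℕ := fun C => ∑ p, sSup (r '' C p)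
  refine Subrelation.wf ?_ (InvImage.wf μ Nat.lt_wfRel.wf)
  rintro D C ⟨hC, m, hne, hs⟩
  have hlt : ∀ p ∈ N.dom m, sSup (r '' D p) < sSup (r '' C p) := by
    intro p hp
    obtain ⟨x, hx, -⟩ := h.eq_singleton hC p
    obtain ⟨y, hy, -⟩ := h.eq_singleton (hC.step hs) p
    rw [hx, hy, Set.image_singleton, Set.image_singleton, csSup_singleton, csSup_singleton]
    exact hσ.rank_lt h hC hne hs hp (hx ▸ rfl) (hy ▸ rfl)
  obtain ⟨p, hp⟩ := h.isNegotiation.dom_nonempty m hs.1.1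
  refine Finset.sum_lt_sum (fun q _ => ?_) ⟨p, Finset.mem_univ p, hlt p hp⟩
  by_cases hq : q ∈ N.dom m
  · exact (hlt q hq).le
  · rw [hs.2.2.2 q hq]

/-- The strategy, applied to the nodes in `A` only, leads to a configuration that enables no node
in `A`. -/
lemma exhaust (hσ : N.IsStrategy S σ r) (h : N.IsSoundDet) (A : Set ν) (hA : N.fin ∉ A)
    {C : Config P ν} (hC : N.Reachable C) :
    ∃ w D, N.Run C w D ∧ (∀ l ∈ w, l.1 ∈ A) ∧ (∀ m, N.Enabled D m → m ∉ A) ∧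
      ∀ p, ∀ x ∈ C p, ∀ y ∈ D p, r y ≤ r x := by
  induction C using (hσ.wellFounded h).induction with | _ C ih
  by_cases hm : ∃ m ∈ A, N.Enabled C m
  · obtain ⟨m, hmA, hm⟩ := hm
    have hne : m ≠ N.fin := fun e => hA (e ▸ hmA)
    obtain ⟨E, hE⟩ := hσ.exists_step h hC hm hne
    obtain ⟨w, D, hw, hwA, hD, hr⟩ := ih E ⟨hC, m, hne, hE⟩ (hC.step hE)
    refine ⟨(m, σ m) :: w, D, ⟨E, hE, hw⟩, ?_, hD, fun p x hx y hy => ?_⟩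
    · intro l hl
      rcases List.mem_cons.1 hl with rfl | hl
      exacts [hmA, hwA l hl]
    · by_cases hp : p ∈ N.dom m
      · obtain ⟨z, hz, -⟩ := h.eq_singleton (hC.step hE) p
        have hz : z ∈ E p := hz ▸ rfl
        exact (hr p z hz y hy).trans (hσ.rank_lt h hC hne hE hp hx hz).le
      · exact hr p x (by rwa [hE.2.2.2 p hp]) y hy
  · refine ⟨[], C, rfl, by simp, fun m hm' hmA => hm ⟨m, hmA, hm'⟩, fun p x hx y hy => ?_⟩
    rw [h.eq_of_mem hC hx hy]

end IsStrategy

/-! ### The nodes that a process visits under a strategy -/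

/-- Under the strategy `σ`, the process `p` passes through `m` when it starts in `x`. -/
def Passes (N : NegDiagram P ν R) (σ : ν → R) (p : P) (x m : ν) : Prop :=
  Relation.ReflTransGen (fun x y => x ≠ N.fin ∧ p ∈ N.dom x ∧ y ∈ N.δ x (σ x) p) x m

namespace IsStrategy

variable {S : Set ν} {σ : ν → R} {r : ν → ℕ}

lemma eq_or_rank_lt (hσ : N.IsStrategy S σ r) {p : P} {x m : ν} (hx : x ∈ S)
    (hp : N.Passes σ p x m) : x = m ∨ r m < r x := by
  induction hp using Relation.ReflTransGen.head_induction_on with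
  | refl => exact .inl rfl
  | head hs _ ih =>
    obtain ⟨hS, hlt⟩ := hσ.next _ hx hs.1 p hs.2.1 _ hs.2.2
    rcases ih hS with rfl | h
    exacts [.inr hlt, .inr (h.trans hlt)]

/-- If one process of a node is bound to visit it, then all of them are. -/
lemma passes_of_passes (hσ : N.IsStrategy S σ r) (h : N.IsSoundDet) {C : Config P ν}
    (hC : N.Reachable C) {m : ν} {p q : P} (hp : p ∈ N.dom m) (hq : q ∈ N.dom m) {x y : ν}
    (hx : x ∈ C q) (hy : y ∈ C p) (hpass : N.Passes σ q x m) : N.Passes σ p y m := by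
  -- Follow the strategy until `m` is executed, when `p` stands at `m`, or until the final
  -- configuration, where no path continues.
  induction C using (hσ.wellFounded h).induction generalizing x y with | _ C ih
  by_cases hfin : C = N.finConfig
  · subst hfin
    obtain rfl : x = N.fin := hx
    obtain rfl : y = N.fin := hy
    rcases Relation.ReflTransGen.cases_head hpass with rfl | ⟨z, hz, -⟩
    · exact .refl
    · exact absurd rfl hz.1
  obtain ⟨w, hw⟩ := h.exists_run_fin hC
  obtain ⟨k, hk⟩ : ∃ k, N.Enabled C k := by
    cases w with
    | nil => exact absurd hw hfin
    | cons l w =>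
      obtain ⟨D, hD, -⟩ := hw
      exact ⟨_, hD.1⟩
  have hne : k ≠ N.fin := by
    rintro rfl
    exact hfin (h.eq_fin_of_enabled hC hk)
  obtain ⟨D, hD⟩ := hσ.exists_step h hC hk hne
  by_cases hm : k = m
  · subst hm
    rw [h.eq_of_mem hC hy (hk.2 p hp)]
    exact .refl
  obtain ⟨x', hx', hpass'⟩ : ∃ x' ∈ D q, N.Passes σ q x' m := by
    by_cases hqk : q ∈ N.dom k
    · obtain rfl := h.eq_of_mem hC hx (hk.2 q hqk)
      rcases Relation.ReflTransGen.cases_head hpass with rfl | ⟨z, hz, hpass'⟩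
      · exact absurd rfl hm
      · exact ⟨z, by rw [hD.2.2.1 q hqk]; exact hz.2.2, hpass'⟩
    · exact ⟨x, by rwa [hD.2.2.2 q hqk], hpass⟩
  obtain ⟨y', hy', -⟩ := h.eq_singleton (hC.step hD) p
  have hy' : y' ∈ D p := hy' ▸ rfl
  have hfinal := ih D ⟨hC, k, hne, hD⟩ (hC.step hD) hx' hy' hpass'
  by_cases hpk : p ∈ N.dom k
  · obtain rfl := h.eq_of_mem hC hy (hk.2 p hpk)
    rw [hD.2.2.1 p hpk] at hy'
    exact Relation.ReflTransGen.head ⟨hne, hpk, hy'⟩ hfinal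
  · rw [hD.2.2.2 p hpk] at hy'
    rwa [h.eq_of_mem hC hy hy']

/-- `D` enables `m`, while the processes of `m` are elsewhere in `C` and do not pass through `m`. -/
def Separates (N : NegDiagram P ν R) (σ : ν → R) (C D : Config P ν) (m : ν) : Prop :=
  N.Enabled D m ∧ ∀ p ∈ N.dom m, C p ≠ D p ∧ ∀ x ∈ C p, ¬ N.Passes σ p x m

/-- Ranks decrease along paths, so `q` cannot get from `c q` to `d q`; by shared fate no process of
`d q` visits it from `c`, while all do from `d`. These processes therefore differ, and maximality of
the rank means that in `d` they have already arrived. -/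
lemma separates_of_rank_le (hσ : N.IsStrategy S σ r) (h : N.IsSoundDet) {c d : P → ν}
    (hC : N.Reachable fun p => {c p}) (hD : N.Reachable fun p => {d p}) {q : P}
    (hq : c q ≠ d q) (hle : r (c q) ≤ r (d q))
    (hmax : ∀ p, c p ≠ d p → r (d p) ≤ r (d q)) :
    Separates N σ (fun p => {c p}) (fun p => {d p}) (d q) := by
  have hnot : ¬ N.Passes σ q (c q) (d q) := fun hp => by
    rcases hσ.eq_or_rank_lt (hσ.mem _ hC q _ rfl) hp with e | hlt
    exacts [hq e, hle.not_gt hlt]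
  obtain ⟨x, hx, hxN, hqx⟩ := h.eq_singleton hD q
  obtain rfl : d q = x := Set.singleton_injective hx
  have hnot' : ∀ p ∈ N.dom (d q), ¬ N.Passes σ p (c p) (d q) := fun p hp hpass =>
    hnot (hσ.passes_of_passes h hC hqx hp (x := c p) rfl rfl hpass)
  have hpass : ∀ p ∈ N.dom (d q), N.Passes σ p (d p) (d q) := fun p hp =>
    hσ.passes_of_passes h hD hp hqx (x := d q) rfl rfl .refl
  have hdiff : ∀ p ∈ N.dom (d q), c p ≠ d p := fun p hp e =>
    hnot' p hp (e ▸ hpass p hp)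
  refine ⟨⟨hxN, fun p hp => ?_⟩, fun p hp => ⟨fun e => hdiff p hp (Set.singleton_injective e), ?_⟩⟩
  · rcases hσ.eq_or_rank_lt (hσ.mem _ hD p _ rfl) (hpass p hp) with e | hlt
    · exact e.symm
    · exact absurd hlt (hmax p (hdiff p hp)).not_gt
  · rintro x rfl
    exact hnot' p hp

lemma exists_separates (hσ : N.IsStrategy S σ r) (h : N.IsSoundDet) {C D : Config P ν}
    (hC : N.Reachable C) (hD : N.Reachable D) (hne : C ≠ D) :
    ∃ m, Separates N σ C D m ∨ Separates N σ D C m := by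
  have := h.isNegotiation.finite_procs
  choose c hc hc' using h.eq_singleton hC
  choose d hd hd' using h.eq_singleton hD
  obtain rfl : C = fun p => {c p} := funext hc
  obtain rfl : D = fun p => {d p} := funext hd
  have hT : {p | c p ≠ d p}.Nonempty := by
    by_contra hT
    refine hne (funext fun p => ?_)
    by_contra hp
    exact hT ⟨p, fun e => hp (congrArg _ e)⟩
  -- The larger of the two ranks at `q` decides which configuration enables the separating node.
  obtain ⟨q, hq, hmax⟩ := Set.exists_max_image _ (fun p => max (r (c p)) (r (d p)))
    (Set.toFinite _) hT
  rcases le_total (r (c q)) (r (d q)) with hle | hle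
  · refine ⟨d q, .inl (hσ.separates_of_rank_le h hC hD hq hle fun p hp => ?_)⟩
    have := hmax p hp
    simp only [max_eq_right hle] at this
    exact (le_max_right _ _).trans this
  · refine ⟨c q, .inr (hσ.separates_of_rank_le h hD hC hq.symm hle fun p hp => ?_)⟩
    have := hmax p hp.symm
    simp only [max_eq_left hle] at this
    exact (le_max_left _ _).trans this

end IsStrategy

/-! ### The configuration `I(n)` -/

lemma IsSoundDet.exists_isFirst [Nonempty R] (h : N.IsSoundDet) {n : ν}
    (hn : N.ReachableNode n) : ∃ C, N.IsFirst n C := by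
  obtain ⟨S, σ, r, hσ⟩ := h.exists_isStrategy
  obtain ⟨C, hC, hCn⟩ := hn
  obtain ⟨w, D, hw, hwA, hD, -⟩ :=
    hσ.exhaust h {m | m ≠ n ∧ m ≠ N.fin} (fun hf => hf.2 rfl) hC
  have hDn : N.Enabled D n := h.enabled_of_run hC hw hCn fun l hl => (hwA l hl).1
  refine ⟨D, hC.run hw, hDn, fun m hm => ?_⟩
  by_contra hne
  -- It remains to exclude `N.fin`: enabling it forces the final configuration, which enables `n`
  -- only if `n = N.fin`.
  refine hD m hm ⟨hne, ?_⟩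
  rintro rfl
  obtain ⟨p, hp⟩ := h.isNegotiation.dom_nonempty n hCn.1
  have := hDn.2 p hp
  rw [h.eq_fin_of_enabled (hC.run hw) hm] at this
  exact hne (Set.mem_singleton_iff.1 this).symm

/-- A separating node is enabled in one of the two, hence is `n`; but both have the processes of `n`
at `n`. -/
lemma IsSoundDet.isFirst_unique [Nonempty R] (h : N.IsSoundDet) {n : ν} {C D : Config P ν}
    (hC : N.IsFirst n C) (hD : N.IsFirst n D) : C = D := by
  obtain ⟨S, σ, r, hσ⟩ := h.exists_isStrategy
  obtain ⟨p, hp⟩ := h.isNegotiation.dom_nonempty n hC.2.1.1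
  have heq : C p = D p := by
    obtain ⟨x, hx, -⟩ := h.eq_singleton hC.1 p
    obtain ⟨y, hy, -⟩ := h.eq_singleton hD.1 p
    have h₁ := hC.2.1.2 p hp
    have h₂ := hD.2.1.2 p hp
    rw [hx] at h₁ ⊢
    rw [hy] at h₂ ⊢
    rw [← Set.mem_singleton_iff.1 h₁, ← Set.mem_singleton_iff.1 h₂]
  by_contra hne
  obtain ⟨m, hm | hm⟩ := hσ.exists_separates h hC.1 hD.1 hne
  · obtain rfl := hD.2.2 m hm.1
    exact (hm.2 p hp).1 heq
  · obtain rfl := hC.2.2 m hm.1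
    exact (hm.2 p hp).1 heq.symm

lemma IsSoundDet.isFirst_first [Nonempty R] (h : N.IsSoundDet) {n : ν}
    (hn : N.ReachableNode n) : N.IsFirst n (N.first n) :=
  Classical.epsilon_spec (h.exists_isFirst hn)

/-! ### The configuration `F(n, a)` -/

lemma isStrictSeq_cons {n : ν} {a : R} {u : List (ν × R)} :
    N.IsStrictSeq (N.dom n) ((n, a) :: u) ↔ ∀ l ∈ u, N.dom l.1 ⊂ N.dom n := by
  refine ⟨fun h => h.2, fun h => ⟨fun l hl => ?_, h⟩⟩
  rcases List.mem_cons.1 hl with rfl | hl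
  exacts [subset_rfl, (h l hl).subset]

/-- `C` is reached from `I(n)` by a strict `n`-sequence that starts with `(n, a)`. -/
def StrictReach (N : NegDiagram P ν R) (n : ν) (a : R) (C : Config P ν) : Prop :=
  ∃ u, N.IsStrictSeq (N.dom n) ((n, a) :: u) ∧ N.Run (N.first n) ((n, a) :: u) C

lemma StrictReach.reachable {n : ν} {a : R} {C : Config P ν} (hC : N.StrictReach n a C)
    (hI : N.IsFirst n (N.first n)) : N.Reachable C :=
  let ⟨_, _, hu⟩ := hC
  hI.1.run hu

lemma StrictReach.run {n : ν} {a : R} {C D : Config P ν} (hC : N.StrictReach n a C)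
    {w : List (ν × R)} (hw : ∀ l ∈ w, N.dom l.1 ⊂ N.dom n) (hr : N.Run C w D) :
    N.StrictReach n a D := by
  obtain ⟨u, hu, hur⟩ := hC
  refine ⟨u ++ w, isStrictSeq_cons.2 fun l hl => ?_, hur.trans hr⟩
  rcases List.mem_append.1 hl with hl | hl
  exacts [isStrictSeq_cons.1 hu l hl, hw l hl]

lemma StrictReach.eq_of_notMem {n : ν} {a : R} {C : Config P ν} (hC : N.StrictReach n a C)
    {p : P} (hp : p ∉ N.dom n) : C p = N.first n p :=
  let ⟨_, hu, hur⟩ := hC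
  hur.eq_of_disjoint fun l hl h => hp (hu.1 l hl h)

lemma StrictReach.of_step {n : ν} {a : R} {G : Config P ν} (hG : N.Step (N.first n) (n, a) G) :
    N.StrictReach n a G :=
  ⟨[], isStrictSeq_cons.2 (by simp), hG.run⟩

lemma IsSoundDet.fin_not_ssubset (h : N.IsSoundDet) (n : ν) : ¬ N.dom N.fin ⊂ N.dom n := by
  rw [h.isNegotiation.dom_fin]
  exact fun hn => hn.2 (Set.subset_univ _)

lemma IsSoundDet.exists_isLast [Nonempty R] (h : N.IsSoundDet) {n : ν} {a : R}
    (hI : N.IsFirst n (N.first n)) (ha : a ∈ N.out n) : ∃ C, N.IsLast n a C := by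
  obtain ⟨S, σ, r, hσ⟩ := h.exists_isStrategy
  obtain ⟨G, hG⟩ := hI.2.1.exists_step ha
  obtain ⟨w, D, hw, hwA, hD, -⟩ :=
    hσ.exhaust h {m | N.dom m ⊂ N.dom n} (h.fin_not_ssubset n) (hI.1.step hG)
  exact ⟨D, (StrictReach.of_step hG).run hwA hw, hD⟩

namespace IsStrategy

variable {S : Set ν} {σ : ν → R} {r : ν → ℕ}

/-- Runs in which every location leaves out some process of `m` do not change whether the
processes of `m` are bound to visit `m`. -/
lemma passes_iff_of_run (hσ : N.IsStrategy S σ r) (h : N.IsSoundDet) {X : Set P} {m : ν}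
    (hX : N.dom m = X) {C D : Config P ν} (hC : N.Reachable C) {u : List (ν × R)}
    (hu : ∀ l ∈ u, N.dom l.1 ⊂ X) (hr : N.Run C u D) :
    (∃ p ∈ X, ∃ x ∈ C p, N.Passes σ p x m) ↔ ∃ p ∈ X, ∃ x ∈ D p, N.Passes σ p x m := by
  subst hX
  have aux : ∀ {C D : Config P ν}, N.Reachable C → ∀ q ∈ N.dom m, C q = D q →
      (∃ p ∈ N.dom m, ∃ x ∈ C p, N.Passes σ p x m) →
      ∃ p ∈ N.dom m, ∃ x ∈ D p, N.Passes σ p x m := by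
    rintro C D hC q hq heq ⟨p, hp, x, hx, hpass⟩
    obtain ⟨y, hy, -⟩ := h.eq_singleton hC q
    have hy : y ∈ C q := hy ▸ rfl
    exact ⟨q, hq, y, heq ▸ hy, hσ.passes_of_passes h hC hq hp hx hy hpass⟩
  induction u generalizing C with
  | nil =>
    cases hr
    rfl
  | cons l u ih =>
    obtain ⟨E, hE, hr⟩ := hr
    refine Iff.trans ?_ (ih (hC.step hE) hr fun l hl => hu l (List.mem_cons_of_mem _ hl))
    -- The process `q` of `m` is not moved by this step, so its fate is unchanged, and the other
    -- processes of `m` share it.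
    obtain ⟨q, hq, hql⟩ := Set.exists_of_ssubset (hu l List.mem_cons_self)
    have heq := hE.2.2.2 q hql
    exact ⟨aux hC q hq heq.symm, aux (hC.step hE) q hq heq⟩

/-- Outside `N.dom n` both configurations agree with I(n), and `D` enables no node of smaller
domain, so `N.dom m = N.dom n`. Both come from the same configuration after `(n, a)` by strict
steps, hence agree on the fate of `m`. -/
lemma not_separates_of_isLast (hσ : N.IsStrategy S σ r) (h : N.IsSoundDet) {n : ν} {a : R}
    (hI : N.IsFirst n (N.first n)) {C D : Config P ν} (hC : N.IsLast n a C)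
    (hD : N.IsLast n a D) {m : ν} (hs : Separates N σ C D m) : False := by
  have hsub : N.dom m ⊆ N.dom n := by
    intro p hp
    by_contra hpn
    refine (hs.2 p hp).1 ?_
    rw [StrictReach.eq_of_notMem hC.1 hpn, StrictReach.eq_of_notMem hD.1 hpn]
  have hdom : N.dom m = N.dom n := by
    by_contra hne
    exact hD.2 m hs.1 (hsub.ssubset_of_ne hne)
  obtain ⟨u, hu, G, hG, hur⟩ := hC.1
  obtain ⟨v, hv, G', hG', hvr⟩ := hD.1
  obtain rfl := hG.unique hG'
  obtain ⟨p, hp⟩ := h.isNegotiation.dom_nonempty m hs.1.1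
  have hpass := (hσ.passes_iff_of_run h hdom (hI.1.step hG) (isStrictSeq_cons.1 hv) hvr).2
    ⟨p, hdom ▸ hp, m, hs.1.2 p hp, .refl⟩
  obtain ⟨q, hq, x, hx, hpass⟩ :=
    (hσ.passes_iff_of_run h hdom (hI.1.step hG) (isStrictSeq_cons.1 hu) hur).1 hpass
  exact (hs.2 q (hdom ▸ hq)).2 x hx hpass

end IsStrategy

lemma IsSoundDet.isLast_unique [Nonempty R] (h : N.IsSoundDet) {n : ν} {a : R}
    (hI : N.IsFirst n (N.first n)) {C D : Config P ν} (hC : N.IsLast n a C)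
    (hD : N.IsLast n a D) : C = D := by
  obtain ⟨S, σ, r, hσ⟩ := h.exists_isStrategy
  by_contra hne
  obtain ⟨m, hm | hm⟩ := hσ.exists_separates h (StrictReach.reachable hC.1 hI)
    (StrictReach.reachable hD.1 hI) hne
  exacts [hσ.not_separates_of_isLast h hI hC hD hm, hσ.not_separates_of_isLast h hI hD hC hm]

lemma IsSoundDet.isLast_last [Nonempty R] (h : N.IsSoundDet) {n : ν} {a : R}
    (hI : N.IsFirst n (N.first n)) (ha : a ∈ N.out n) : N.IsLast n a (N.last n a) :=
  Classical.epsilon_spec (h.exists_isLast hI ha)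

/-- Exhausting the nodes of smaller domain ends in a configuration satisfying `IsLast`, and there is
only one. The rank bound serves `IsSoundDet.notMem_last`. -/
lemma IsStrategy.exists_run_last {S : Set ν} {σ : ν → R} {r : ν → ℕ} (hσ : N.IsStrategy S σ r)
    (h : N.IsSoundDet) {n : ν} {a : R} (hI : N.IsFirst n (N.first n)) {C : Config P ν}
    (hC : N.StrictReach n a C) :
    ∃ w, N.Run C w (N.last n a) ∧ (∀ l ∈ w, N.dom l.1 ⊂ N.dom n) ∧
      ∀ p, ∀ x ∈ C p, ∀ y ∈ N.last n a p, r y ≤ r x := by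
  obtain ⟨w, D, hw, hwA, hD, hr⟩ :=
    hσ.exhaust h {m | N.dom m ⊂ N.dom n} (h.fin_not_ssubset n) (hC.reachable hI)
  have hlast : N.IsLast n a D := ⟨hC.run hwA hw, hD⟩
  have : Nonempty R := ⟨a⟩
  have heq : D = N.last n a := h.isLast_unique hI hlast (Classical.epsilon_spec ⟨D, hlast⟩)
  rw [heq] at hw hr
  exact ⟨w, hw, hwA, hr⟩

lemma IsSoundDet.exists_run_last (h : N.IsSoundDet) {n : ν} {a : R}
    (hI : N.IsFirst n (N.first n)) {C : Config P ν} (hC : N.StrictReach n a C) :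
    ∃ w, N.Run C w (N.last n a) ∧ ∀ l ∈ w, N.dom l.1 ⊂ N.dom n := by
  have : Nonempty R := ⟨a⟩
  obtain ⟨S, σ, r, hσ⟩ := h.exists_isStrategy
  obtain ⟨w, hw, hwA, -⟩ := hσ.exists_run_last h hI hC
  exact ⟨w, hw, hwA⟩

/-- No process waits in `F(n, a)` for a node that was enabled on the way. -/
lemma IsSoundDet.notMem_last (h : N.IsSoundDet) {n : ν} {a : R}
    (hI : N.IsFirst n (N.first n)) {C : Config P ν} (hC : N.StrictReach n a C) {k : ν}
    (hk : N.Enabled C k) (hkn : N.dom k ⊂ N.dom n) {p : P} (hp : p ∈ N.dom k) :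
    k ∉ N.last n a p := by
  have : Nonempty R := ⟨a⟩
  obtain ⟨S, σ, r, hσ⟩ := h.exists_isStrategy
  have hne : k ≠ N.fin := by
    rintro rfl
    exact h.fin_not_ssubset n hkn
  -- Executing `k` by the strategy lowers the rank of `p` strictly, and the run on to F(n, a) never
  -- raises it again.
  obtain ⟨D, hD⟩ := hσ.exists_step h (hC.reachable hI) hk hne
  have hDs : N.StrictReach n a D := hC.run (by simpa using hkn) hD.run
  obtain ⟨w, -, -, hr⟩ := hσ.exists_run_last h hI hDs
  obtain ⟨y, hy, -⟩ := h.eq_singleton (hDs.reachable hI) p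
  have hy : y ∈ D p := hy ▸ rfl
  intro hkl
  exact (hr p y hy k hkl).not_gt
    (hσ.rank_lt h (hC.reachable hI) hne hD hp (hk.2 p hp) hy)

/-- A configuration reached by a strict sequence in which all processes of `n` are back in `n`
is `F(n, a)`. -/
lemma IsSoundDet.eq_last_of_enabled (h : N.IsSoundDet) {n : ν} {a : R}
    (hI : N.IsFirst n (N.first n)) {C : Config P ν} (hC : N.StrictReach n a C)
    (hn : N.Enabled C n) : C = N.last n a := by
  obtain ⟨w, hw, hwA⟩ := h.exists_run_last hI hC
  cases w with
  | nil => exact hw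
  | cons l w =>
    obtain ⟨D, hD, -⟩ := hw
    have hl := hwA l List.mem_cons_self
    obtain ⟨p, hp⟩ := h.isNegotiation.dom_nonempty l.1 hD.1.1
    -- A further strict location would involve a process of `n`, all of which are ready for `n`
    -- only.
    rw [h.eq_of_enabled (hC.reachable hI) hD.1 hn hp (hl.subset hp)] at hl
    exact absurd hl (ssubset_irrefl _)

/-! ### The locations that appear in strict sequences -/

lemma Appears.eq_or_ssubset {n : ν} {a : R} {l : ν × R} (hl : N.Appears n a l) :
    l = (n, a) ∨ N.dom l.1 ⊂ N.dom n := by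
  obtain ⟨u, hu, -, hl⟩ := hl
  exact (List.mem_cons.1 hl).imp_right (isStrictSeq_cons.1 hu l)

lemma Appears.subset {n : ν} {a : R} {l : ν × R} (hl : N.Appears n a l) :
    N.dom l.1 ⊆ N.dom n := by
  obtain ⟨u, hu, -, hl⟩ := hl
  exact hu.1 l hl

lemma Appears.mem {n : ν} {a : R} {l : ν × R} (hl : N.Appears n a l) :
    l.1 ∈ N.nodes ∧ l.2 ∈ N.out l.1 := by
  obtain ⟨u, -, hr, hl⟩ := hl
  obtain ⟨s, t, e⟩ := List.append_of_mem hl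
  rw [e] at hr
  obtain ⟨E, -, D, hD, -⟩ := run_append.1 hr
  exact ⟨hD.1.1, hD.2.1⟩

lemma StrictReach.appears {n : ν} {a : R} {C : Config P ν} (hC : N.StrictReach n a C)
    {w : List (ν × R)} (hw : ∀ l ∈ w, N.dom l.1 ⊂ N.dom n) (hr : N.Run C w (N.last n a))
    {l : ν × R} (hl : l ∈ w) : N.Appears n a l := by
  obtain ⟨u, hu, hur⟩ := hC
  refine ⟨u ++ w, isStrictSeq_cons.2 fun l hl => ?_, hur.trans hr, by simp [hl]⟩
  rcases List.mem_append.1 hl with hl | hl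
  exacts [isStrictSeq_cons.1 hu l hl, hw l hl]

lemma IsLast.appears {n : ν} {a : R} (hF : N.IsLast n a (N.last n a)) : N.Appears n a (n, a) :=
  let ⟨u, hu, hur⟩ := hF.1
  ⟨u, hu, hur, List.mem_cons_self⟩

lemma IsSoundDet.exists_mem_of_run (h : N.IsSoundDet) {C D : Config P ν} (hC : N.Reachable C)
    {w : List (ν × R)} (hw : N.Run C w D) {p : P} {x : ν} (hx : x ∈ C p) (hne : C p ≠ D p) :
    ∃ b, (x, b) ∈ w := by
  induction w generalizing C with
  | nil =>
    cases hw
    exact absurd rfl hne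
  | cons l w ih =>
    obtain ⟨E, hE, hw⟩ := hw
    by_cases hp : p ∈ N.dom l.1
    · refine ⟨l.2, ?_⟩
      rw [h.eq_of_mem hC hx (hE.1.2 p hp)]
      exact List.mem_cons_self
    · have heq := hE.2.2.2 p hp
      obtain ⟨b, hb⟩ := ih (hC.step hE) hw (heq ▸ hx) (heq ▸ hne)
      exact ⟨b, List.mem_cons_of_mem _ hb⟩

/-- To get from `x` to a different value in F(n, a), the process must take part in a location of `x`
later in the same sequence. -/
lemma IsSoundDet.appears_next (h : N.IsSoundDet) {n : ν} {a : R}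
    (hI : N.IsFirst n (N.first n)) {m : ν} {b : R} (hl : N.Appears n a (m, b)) {p : P}
    (hp : p ∈ N.dom m) (hne : N.δ m b p ≠ N.last n a p) {x : ν} (hx : x ∈ N.δ m b p) :
    ∃ c, N.Appears n a (x, c) := by
  obtain ⟨u, hu, hr, hl⟩ := hl
  obtain ⟨s, t, e⟩ := List.append_of_mem hl
  have hr' := hr
  rw [e] at hr'
  obtain ⟨E, hE, D, hD, ht⟩ := run_append.1 hr'
  have heq : D p = N.δ m b p := hD.2.2.1 p hp
  obtain ⟨c, hc⟩ := h.exists_mem_of_run ((hI.1.run hE).step hD) ht (p := p)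
    (by rwa [heq]) (by rwa [heq])
  exact ⟨c, u, hu, hr, by rw [e]; simp [hc]⟩

/-! ### The subnegotiation -/

lemma IsSoundDet.isNegotiation_subLoc (h : N.IsSoundDet) {n : ν} {a : R}
    (hI : N.IsFirst n (N.first n)) (hF : N.IsLast n a (N.last n a)) :
    (N.subLoc n a).IsNegotiation where
  finite_procs := by
    have := h.isNegotiation.finite_procs
    exact Subtype.finite
  finite_nodes := by
    refine ((h.isNegotiation.finite_nodes.image some).insert none).subset ?_
    rintro x (rfl | ⟨m, b, rfl, hm⟩)
    · exact .inl rfl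
    · exact .inr ⟨m, hm.mem.1, rfl⟩
  init_mem := .inr ⟨n, a, rfl, hF.appears⟩
  fin_mem := .inl rfl
  dom_nonempty := by
    rintro x (rfl | ⟨m, b, rfl, hm⟩)
    · obtain ⟨p, hp⟩ := h.isNegotiation.dom_nonempty n hI.2.1.1
      exact ⟨⟨p, hp⟩, trivial⟩
    · obtain ⟨p, hp⟩ := h.isNegotiation.dom_nonempty m hm.mem.1
      exact ⟨⟨p, hm.subset hp⟩, hp⟩
  dom_init := Set.eq_univ_of_forall fun p => p.2
  dom_fin := rfl
  out_nonempty := by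
    rintro x (rfl | ⟨m, b, rfl, hm⟩) hx
    exacts [absurd rfl hx, ⟨b, hm⟩]
  δ_mem := by
    rintro x (rfl | ⟨m, -, rfl, -⟩) b hb p hp y hy
    · exact hb.elim
    · simp only [subLoc] at hy
      split_ifs at hy with heq
      · obtain rfl := Set.mem_singleton_iff.1 hy
        exact ⟨.inl rfl, trivial⟩
      · obtain ⟨z, hz, rfl⟩ := hy
        have hb : N.Appears n a (m, b) := hb
        obtain ⟨c, hc⟩ := h.appears_next hI hb hp heq hz
        exact ⟨.inr ⟨z, c, rfl, hc⟩, (h.isNegotiation.δ_mem m hb.mem.1 b hb.mem.2 p hp z hz).2⟩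

lemma IsSoundDet.deterministic_subLoc (h : N.IsSoundDet) {n : ν} {a : R} :
    (N.subLoc n a).Deterministic := by
  rintro x (rfl | ⟨m, -, rfl, -⟩) b hb p hp
  · exact hb.elim
  · have hb : N.Appears n a (m, b) := hb
    simp only [subLoc]
    split_ifs
    · exact Set.subsingleton_singleton
    · exact (h.deterministic m hb.mem.1 b hb.mem.2 p hp).image _

open Classical in
/-- The configuration of the subnegotiation that corresponds to a configuration of `N`. -/
noncomputable def subConfig (N : NegDiagram P ν R) (n : ν) (a : R) (C : Config P ν) :
    Config (N.dom n) (Option ν) :=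
  fun p => if C p = N.last n a p then {none} else some '' C p

lemma some_mem_subConfig {n : ν} {a : R} {C : Config P ν} {p : N.dom n} {m : ν} :
    some m ∈ N.subConfig n a C p ↔ C p ≠ N.last n a p ∧ m ∈ C p := by
  unfold subConfig
  split_ifs with heq <;> simp [heq]

lemma subConfig_last {n : ν} {a : R} :
    N.subConfig n a (N.last n a) = (N.subLoc n a).finConfig := by
  funext p
  exact if_pos rfl

lemma subConfig_of_step {n : ν} {a : R} {C D : Config P ν} {l : ν × R} (hD : N.Step C l D)
    {p : N.dom n} (hp : (p : P) ∈ N.dom l.1) :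
    N.subConfig n a D p = (N.subLoc n a).δ (some l.1) l.2 p := by
  simp only [subConfig, subLoc, hD.2.2.1 p hp]

lemma subConfig_of_step' {n : ν} {a : R} {C D : Config P ν} {l : ν × R} (hD : N.Step C l D)
    {p : N.dom n} (hp : (p : P) ∉ N.dom l.1) : N.subConfig n a D p = N.subConfig n a C p := by
  simp only [subConfig, hD.2.2.2 p hp]

/-- The danger is that a process ready for `l.1` was already redirected to `none`; `notMem_last`
excludes this. -/
lemma IsSoundDet.subLoc_step (h : N.IsSoundDet) {n : ν} {a : R}
    (hI : N.IsFirst n (N.first n)) {C D : Config P ν} (hC : N.StrictReach n a C) {l : ν × R}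
    (hl : N.Appears n a l) (hln : N.dom l.1 ⊂ N.dom n) (hD : N.Step C l D) :
    (N.subLoc n a).Step (N.subConfig n a C) (some l.1, l.2) (N.subConfig n a D) := by
  refine ⟨⟨.inr ⟨l.1, l.2, rfl, hl⟩, fun p hp => ?_⟩, hl, fun p hp => subConfig_of_step hD hp,
    fun p hp => subConfig_of_step' hD hp⟩
  have hmem := hD.1.2 p hp
  exact some_mem_subConfig.2 ⟨fun e => h.notMem_last hI hC hD.1 hln hp (e ▸ hmem), hmem⟩

lemma IsSoundDet.exists_of_subLoc_step (h : N.IsSoundDet) {n : ν} {a : R}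
    (hI : N.IsFirst n (N.first n)) {C : Config P ν} (hC : N.StrictReach n a C)
    {l : Option ν × R} {D' : Config (N.dom n) (Option ν)}
    (hD' : (N.subLoc n a).Step (N.subConfig n a C) l D') :
    ∃ D, N.StrictReach n a D ∧ D' = N.subConfig n a D := by
  obtain ⟨_ | m, b⟩ := l
  · exact hD'.2.1.elim
  have hl : N.Appears n a (m, b) := hD'.2.1
  have hmem : ∀ p (hp : p ∈ N.dom m), C p ≠ N.last n a p ∧ m ∈ C p := fun p hp =>
    some_mem_subConfig.1 (hD'.1.2 ⟨p, hl.subset hp⟩ hp)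
  have hm : N.Enabled C m := ⟨hl.mem.1, fun p hp => (hmem p hp).2⟩
  have hmn : N.dom m ⊂ N.dom n := by
    -- The node `n` cannot be executed a second time: with all its processes back at `n`, the
    -- configuration is F(n, a), which `subConfig` sends to `none`.
    rcases hl.eq_or_ssubset with e | hlt
    · obtain ⟨rfl, rfl⟩ := Prod.mk.inj e
      obtain ⟨p, hp⟩ := h.isNegotiation.dom_nonempty m hm.1
      exact absurd (congrFun (h.eq_last_of_enabled hI hC hm) p) (hmem p hp).1
    · exact hlt
  obtain ⟨D, hD⟩ := hm.exists_step hl.mem.2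
  refine ⟨D, hC.run (by simpa using hmn) hD.run, funext fun p => ?_⟩
  by_cases hp : (p : P) ∈ N.dom m
  · rw [subConfig_of_step hD hp]
    exact hD'.2.2.1 p hp
  · rw [subConfig_of_step' hD hp]
    exact hD'.2.2.2 p hp

lemma subLoc_step_init {n : ν} {a : R} (hF : N.IsLast n a (N.last n a)) {G : Config P ν}
    (hG : N.Step (N.first n) (n, a) G) :
    (N.subLoc n a).Step (N.subLoc n a).initConfig (some n, a) (N.subConfig n a G) :=
  ⟨⟨.inr ⟨n, a, rfl, hF.appears⟩, fun _ _ => rfl⟩, hF.appears,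
    fun _ hp => subConfig_of_step hG hp, fun p hp => absurd p.2 hp⟩

lemma IsSoundDet.eq_of_subLoc_step_init (h : N.IsSoundDet) {n : ν} {a : R}
    {l : Option ν × R} {D' : Config (N.dom n) (Option ν)}
    (hD' : (N.subLoc n a).Step (N.subLoc n a).initConfig l D') : l = (some n, a) := by
  obtain ⟨_ | m, b⟩ := l
  · exact hD'.2.1.elim
  have hl : N.Appears n a (m, b) := hD'.2.1
  obtain ⟨p, hp⟩ := h.isNegotiation.dom_nonempty m hl.mem.1
  obtain rfl : m = n := Option.some_injective _ (hD'.1.2 ⟨p, hl.subset hp⟩ hp)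
  rcases hl.eq_or_ssubset with e | hlt
  · rw [(Prod.mk.inj e).2]
  · exact absurd hlt (ssubset_irrefl _)

/-- The initial configuration is kept apart because it need not be the image of I(n): if a process
is at `n` in F(n, a) as well, `subConfig` sends it to `none`. -/
lemma IsSoundDet.subLoc_reachable (h : N.IsSoundDet) {n : ν} {a : R}
    (hI : N.IsFirst n (N.first n)) (hF : N.IsLast n a (N.last n a)) {G : Config P ν}
    (hG : N.Step (N.first n) (n, a) G) {C' : Config (N.dom n) (Option ν)}
    (hC' : (N.subLoc n a).Reachable C') :
    C' = (N.subLoc n a).initConfig ∨ ∃ C, N.StrictReach n a C ∧ C' = N.subConfig n a C := by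
  refine Reachable.induction (motive := fun C' => C' = (N.subLoc n a).initConfig ∨
    ∃ C, N.StrictReach n a C ∧ C' = N.subConfig n a C) (.inl rfl) ?_ hC'
  rintro C' l D' (rfl | ⟨C, hC, rfl⟩) hs
  · obtain rfl := h.eq_of_subLoc_step_init hs
    exact .inr ⟨G, .of_step hG, hs.unique (subLoc_step_init hF hG)⟩
  · exact .inr (h.exists_of_subLoc_step hI hC hs)

lemma IsSoundDet.subLoc_run_fin (h : N.IsSoundDet) {n : ν} {a : R}
    (hI : N.IsFirst n (N.first n)) {C : Config P ν} (hC : N.StrictReach n a C) :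
    ∃ w, (N.subLoc n a).Run (N.subConfig n a C) w (N.subLoc n a).finConfig := by
  obtain ⟨w, hw, hwn⟩ := h.exists_run_last hI hC
  induction w generalizing C with
  | nil =>
    cases hw
    exact ⟨[], subConfig_last⟩
  | cons l w ih =>
    have hl := hC.appears hwn hw List.mem_cons_self
    obtain ⟨D, hD, hw⟩ := hw
    have hln := hwn l List.mem_cons_self
    obtain ⟨v, hv⟩ := ih (hC.run (by simpa using hln) hD.run) hw
      fun l' hl' => hwn l' (List.mem_cons_of_mem _ hl')
    exact ⟨(some l.1, l.2) :: v, _, h.subLoc_step hI hC hl hln hD, hv⟩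

lemma IsSoundDet.sound_subLoc (h : N.IsSoundDet) {n : ν} {a : R}
    (hI : N.IsFirst n (N.first n)) (hF : N.IsLast n a (N.last n a)) : (N.subLoc n a).Sound := by
  obtain ⟨-, -, G, hG, -⟩ := hF.1
  intro w C' hw
  rcases h.subLoc_reachable hI hF hG ⟨w, hw⟩ with rfl | ⟨C, hC, rfl⟩
  · obtain ⟨v, hv⟩ := h.subLoc_run_fin hI (StrictReach.of_step hG)
    exact ⟨(some n, a) :: v, _, subLoc_step_init hF hG, hv⟩
  · exact h.subLoc_run_fin hI hC

end NegDiagram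

theorem mainTheorem4 {P ν R : Type*} (N : NegDiagram P ν R) (hN : N.IsNegotiation)
    (hdet : N.Deterministic) (hsound : N.Sound)
    (n : ν) (hn : N.ReachableNode n) (a : R) (ha : a ∈ N.out n) :
    (∃! C, N.IsFirst n C) ∧ (∃! C, N.IsLast n a C) ∧
      (N.subLoc n a).IsNegotiation ∧ (N.subLoc n a).Deterministic ∧ (N.subLoc n a).Sound := by
  have h : N.IsSoundDet := ⟨hN, hdet, hsound⟩
  have : Nonempty R := ⟨a⟩
  have hI := h.isFirst_first hn
  have hF := h.isLast_last hI ha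
  exact ⟨⟨_, hI, fun C hC => h.isFirst_unique hC hI⟩,
    ⟨_, hF, fun C hC => h.isLast_unique hI hC hF⟩,
    h.isNegotiation_subLoc hI hF, h.deterministic_subLoc, h.sound_subLoc hI hF⟩
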